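/- Let $(R,\mathfrak m)$ be a Cohen–Macaulay (in particular Noetherian) commutative local ring with $2\notin\mathfrak m$; $R$ need not be a domain. Let $A$ be a codimension 2 Gorenstein algebra over $R$, i.e. a commutative $R$-algebra, finitely generated as an $R$-module, with $\dim R-\dim_R A=2$ and $A\cong\mathrm{Ext}^2_R(A,R)$ as $A$-modules, where $a\in A$ acts on $\mathrm{Ext}^2_R(A,R)$ as the map induced by multiplication by $a$ on $A$; assume moreover that $A$ has projective dimension at most $2$ as an $R$-module (so that $A$ is a perfect $R$-module). Then there are $n\in\mathbb N$ and $n\times n$ matrices $\alpha,\beta$ over $R$ such that $A$ has a resolution $$0\longrightarrow R^n\xrightarrow{\binom{-\beta^t}{\alpha^t}}R^{2n}\xrightarrow{(\alpha\ \beta)}R^n\longrightarrow A\longrightarrow 0$$ by $R$-linear maps, $\alpha\beta^t=\beta\alpha^t$, and this same resolution is of Koszul module type: $\det\alpha,\det\beta$ is a regular sequence on $R$ (in particular these two elements generate a proper ideal), and there is a unit $\lambda\in R$ with $\det(-\beta^t)=(-1)^n\lambda\det\beta$ and $\det(\alpha^t)=\lambda\det\alpha$. -/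

import Mathlib

universe u

open CategoryTheory CategoryTheory.Abelian RingTheory.Sequence

/-- A Noetherian local ring is Cohen-Macaulay if its depth equals its Krull dimension. A regular
sequence in the maximal ideal never has more than `dim R` terms, so this means that some regular
sequence in the maximal ideal has exactly `dim R` terms. -/
def IsCohenMacaulayLocal (R : Type u) [CommRing R] [IsLocalRing R] [IsNoetherianRing R] : Prop :=
  ∃ rs : List R, (∀ r ∈ rs, r ∈ IsLocalRing.maximalIdeal R) ∧ IsRegular R rs ∧
    (rs.length : WithBot ℕ∞) = ringKrullDim R

/-- Multiplication by `a : A`, as an endomorphism of `A` in the category of `R`-modules. -/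
noncomputable def mulEnd (R A : Type u) [CommRing R] [CommRing A] [Algebra R A] (a : A) :
    ModuleCat.of R A ⟶ ModuleCat.of R A :=
  ModuleCat.ofHom (LinearMap.mulLeft R a)

/-- `A` is a Gorenstein algebra of codimension 2 over `R`: a finite `R`-algebra with
`dim R - dim_R A = 2` and `A ≅ Ext²_R(A, R)` as `A`-modules, where `a : A` acts on `Ext²_R(A, R)`
as the map that multiplication by `a` on `A` induces by functoriality. (The difference of
dimensions is written additively; since `dim R` is finite, `A = 0`, of dimension `⊥`, does not
qualify.) -/
structure IsGorensteinAlgebraCodimTwo (R A : Type u) [CommRing R] [CommRing A] [Algebra R A] :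
    Prop where
  finite : Module.Finite R A
  codim : Module.supportDim R A + 2 = ringKrullDim R
  duality : ∃ e : A ≃+ Ext.{u} (ModuleCat.of R A) (ModuleCat.of R R) 2,
    ∀ a x : A, e (a * x) = (Ext.mk₀ (mulEnd R A a)).comp (e x) (zero_add 2)

/-- The matrices `ρ₁, ρ₂, τ₁, τ₂` and the map `ε` form a resolution
`0 ⟶ Rⁿ ⟶ R²ⁿ ⟶ Rⁿ ⟶ M ⟶ 0` whose maps are the block matrices
`ρ` (with `ρ₁` above `ρ₂`) and `τ = (τ₁ τ₂)` acting on column vectors, followed by `ε`. -/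
structure IsBlockResolution {R : Type u} [CommRing R] {M : Type u} [AddCommGroup M] [Module R M]
    {n : ℕ} (ρ₁ ρ₂ τ₁ τ₂ : Matrix (Fin n) (Fin n) R) (ε : (Fin n → R) →ₗ[R] M) : Prop where
  injective : Function.Injective (Matrix.fromRows ρ₁ ρ₂).mulVecLin
  exact_middle : Function.Exact (Matrix.fromRows ρ₁ ρ₂).mulVecLin
    (Matrix.fromCols τ₁ τ₂).mulVecLin
  exact_right : Function.Exact (Matrix.fromCols τ₁ τ₂).mulVecLin ε
  surjective : Function.Surjective ε

/-- The condition on the blocks of a resolution that makes the resolved module a Koszul module: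
`det τ₁, det τ₂` is a regular sequence on `R`, and there is a unit `c` with
`det ρ₁ = (-1)ⁿ c det τ₂` and `det ρ₂ = c det τ₁`. -/
def IsKoszulType {R : Type u} [CommRing R] {n : ℕ} (ρ₁ ρ₂ τ₁ τ₂ : Matrix (Fin n) (Fin n) R) :
    Prop :=
  IsRegular R [τ₁.det, τ₂.det] ∧
    ∃ c : Rˣ, ρ₁.det = (-1) ^ n * (c : R) * τ₂.det ∧ ρ₂.det = (c : R) * τ₁.det

/-!
# Gorenstein algebras of codimension two are Koszul modules

Cohen-Macaulayness turns the codimension hypothesis into a regular sequence `x, y` that kills `A`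
(`exists_regular_pair_mem_annihilator`). As the projective dimension is at most two, `A` has a
minimal free resolution `0 ⟶ F₂ ⟶ F₁ ⟶ F₀ ⟶ A ⟶ 0`, and `Ext²(A, R)` is the cokernel of
`F₁* ⟶ F₂*` (`exists_addMonoidHom_ext_two`).

The algebra structure of `A` lifts to a graded commutative multiplication on the resolution
(`exists_resolution_products`). Let `u : F₂ → R` represent the class that corresponds to `1 : A`
under the duality isomorphism. Composing the multiplication with `u` gives an alternating form on
`F₁` and a pairing of `F₀` with `F₂`. Since the isomorphism is `A`-linear, the map `F₀ ⟶ F₂*` lifts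
it, and so Nakayama's lemma and minimality make both pairings perfect (`exists_perfect_pairings`);
the vanishing of `Ext¹(A, R)` that enters here follows directly from `x` and `y`. The Leibniz rule
says that the two differentials are adjoint. A symplectic basis of `F₁` (`exists_symplectic_basis`),
whose rank is `2 rank F₀` (`finrank_eq_add_of_annihilated`), therefore turns the differentials into
`(α β)` and `(-βᵗ, αᵗ)` (`exists_isBlockResolution`), and `αβᵗ = βαᵗ` expresses that they compose
to zero.

It remains to choose the symplectic basis such that `det α, det β` is a regular sequence. The rows
of `(α β)` span a Lagrangian subspace modulo every prime that does not contain the annihilator of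
`A`, and a Lagrangian subspace is transversal to some coordinate Lagrangian
(`exists_det_ite_ne_zero`). Hence a diagonal shear `α ↦ α + βD` moves `det α` out of finitely many
such primes (`exists_det_add_mul_diagonal_notMem`); the residue field may be finite, so the
entries of `D` are found among polynomial expressions in an element `t` of the maximal ideal that
lies outside the primes in question, modulo which its powers are therefore distinct. One shear of
`α` avoids the associated primes of `R`, a second one, of `β`, those of `R / det α`
(`IsBlockResolution.exists_isRegular_det`). The unit in the Koszul condition is `1`, as
transposition does not change determinants.
-/

/-! ### Regular sequences in the annihilator -/

section Grade

open IsLocalRing Pointwise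

variable {R : Type u} [CommRing R] [IsLocalRing R] [IsNoetherianRing R]

/-- If `x` is `M`-regular, each associated prime of `M` together with `x` lies in an associated
prime of `M / xM`: by Nakayama the submodule killed by `p` is not contained in `xM`. -/
lemma exists_isAssociatedPrime_quotSMulTop {M : Type*} [AddCommGroup M] [Module R M]
    [Module.Finite R M] {x : R} (hx : x ∈ maximalIdeal R) (hreg : IsSMulRegular M x)
    {p : Ideal R} (hp : IsAssociatedPrime p M) :
    ∃ q : Ideal R, IsAssociatedPrime q (QuotSMulTop x M) ∧ p ≤ q ∧ x ∈ q := by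
  obtain ⟨hprime, z, hz⟩ := isAssociatedPrime_iff.mp hp
  let N : Submodule R M :=
    { carrier := {w | ∀ r ∈ p, r • w = 0}
      add_mem' := fun {a b} ha hb r hr => by rw [smul_add, ha r hr, hb r hr, add_zero]
      zero_mem' := fun r _ => smul_zero r
      smul_mem' := fun c w hw r hr => by rw [smul_comm, hw r hr, smul_zero] }
  have hzN : z ∈ N := fun r hr => by
    rw [hz, Submodule.mem_colon_singleton] at hr
    simpa using hr
  have hz0 : z ≠ 0 := by
    rintro rfl
    apply hprime.ne_top
    rw [hz]
    ext r
    simp [Submodule.mem_colon_singleton]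
  have hN : N ≠ ⊥ := fun h => hz0 (by simpa [h] using hzN)
  have key : ∃ w ∈ N, w ∉ x • (⊤ : Submodule R M) := by
    by_contra! hcon
    refine hN (Submodule.eq_bot_of_le_smul_of_le_jacobson_bot (maximalIdeal R) N
      (IsNoetherian.noetherian N) (fun w hw => ?_) (by rw [jacobson_eq_maximalIdeal _ bot_ne_top]))
    obtain ⟨v, -, hv⟩ := (Submodule.mem_smul_pointwise_iff_exists _ _ _).mp (hcon w hw)
    rw [← hv]
    refine Submodule.smul_mem_smul hx fun r hr => hreg ?_
    simp only [smul_zero]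
    rw [smul_comm, hv, hw r hr]
  obtain ⟨w, hwN, hwx⟩ := key
  have hw0 : (Submodule.Quotient.mk w : QuotSMulTop x M) ≠ 0 := by
    rwa [Ne, Submodule.Quotient.mk_eq_zero]
  obtain ⟨q, hq, hle⟩ := exists_le_isAssociatedPrime_of_isNoetherianRing R _ hw0
  refine ⟨q, hq, fun r hr => hle ?_, hle ?_⟩
  · rw [Submodule.mem_colon_singleton, ← Submodule.Quotient.mk_smul, hwN r hr]
    simp
  · rw [Submodule.mem_colon_singleton, ← Submodule.Quotient.mk_smul, Submodule.mem_bot,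
      Submodule.Quotient.mk_eq_zero]
    exact Submodule.smul_mem_pointwise_smul _ _ _ trivial

/-- The depth of `M` is at most `dim R / p` for every associated prime `p` of `M`. -/
lemma length_le_ringKrullDim_quotient_of_isAssociatedPrime {rs : List R}
    (hmem : ∀ r ∈ rs, r ∈ maximalIdeal R) {M : Type*} [AddCommGroup M] [Module R M]
    [Module.Finite R M] (hreg : IsRegular M rs) {p : Ideal R} (hp : IsAssociatedPrime p M) :
    (rs.length : WithBot ℕ∞) ≤ ringKrullDim (R ⧸ p) := by
  induction rs generalizing M p with
  | nil =>
    have := hp.isPrime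
    simpa using ringKrullDim_nonneg_of_nontrivial
  | cons x rs ih =>
    rw [isRegular_cons_iff] at hreg
    have hx : x ∈ maximalIdeal R := hmem x (by simp)
    obtain ⟨q, hq, hpq, hxq⟩ := exists_isAssociatedPrime_quotSMulTop hx hreg.1 hp
    have hprime := hp.isPrime
    have hxp : x ∉ p := by
      have h : x ∉ ⋃ p ∈ associatedPrimes R M, (p : Set R) := by
        rw [biUnion_associatedPrimes_eq_compl_regular]
        exact fun h => h hreg.1
      exact fun hxp => h (Set.mem_biUnion hp hxp)
    have h1 := ih (fun r hr => hmem r (by simp [hr])) hreg.2 hq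
    have h2 : ringKrullDim (R ⧸ q) + 1 ≤ ringKrullDim (R ⧸ p) := by
      refine ringKrullDim_succ_le_of_surjective (Ideal.Quotient.factor hpq)
        (Ideal.Quotient.factor_surjective hpq) (r := Ideal.Quotient.mk p x) ?_ ?_
      · rw [mem_nonZeroDivisors_iff_ne_zero]
        rwa [Ne, Ideal.Quotient.eq_zero_iff_mem]
      · rw [Ideal.Quotient.factor_mk]
        exact Ideal.Quotient.eq_zero_iff_mem.mpr hxq
    refine le_trans ?_ h2
    simp only [List.length_cons, Nat.cast_add, Nat.cast_one]
    gcongr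

/-- Dividing by any regular element of the maximal ideal lowers the depth by at most one. -/
lemma exists_isRegular_quotSMulTop {M : Type u} [AddCommGroup M] [Module R M] [Module.Finite R M]
    {rs : List R} (hmem : ∀ r ∈ rs, r ∈ maximalIdeal R) (hreg : IsRegular M rs)
    {x : R} (hx : x ∈ maximalIdeal R) (hxreg : IsSMulRegular M x) :
    ∃ rs' : List R, rs'.length = rs.length - 1 ∧ (∀ r ∈ rs', r ∈ maximalIdeal R) ∧
      IsRegular (QuotSMulTop x M) rs' := by
  have := hreg.nontrivial
  let N := ModuleCat.of R (R ⧸ maximalIdeal R)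
  have hsupp : Module.support R N = PrimeSpectrum.zeroLocus (maximalIdeal R) := by
    rw [Module.support_eq_zeroLocus, Ideal.annihilator_quotient]
  have hlt : ∀ (L : Type u) [AddCommGroup L] [Module R L] [Module.Finite R L] [Nontrivial L],
      maximalIdeal R • (⊤ : Submodule R L) < ⊤ := fun L _ _ _ _ =>
    (Submodule.top_ne_ideal_smul_of_le_jacobson_annihilator
      (maximalIdeal_le_jacobson _)).symm.lt_top
  have hext := ModuleCat.subsingleton_ext_of_exists_isRegular (maximalIdeal R) N hsupp.subset
    (ModuleCat.of R M) (hlt M) rs hmem hreg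
  have : Nontrivial (QuotSMulTop x M) := nontrivial_quotSMulTop_of_mem_maximalIdeal M hx
  refine ModuleCat.exists_isRegular_of_exists_subsingleton_ext (maximalIdeal R) (rs.length - 1)
    (ModuleCat.of R (QuotSMulTop x M)) (hlt _) N hsupp fun i hi => ?_
  have zero1 := AddCommGrpCat.isZero_of_iff_subsingleton.mpr (hext i (by omega))
  have zero2 := AddCommGrpCat.isZero_of_iff_subsingleton.mpr (hext (i + 1) (by omega))
  have hxreg' : IsSMulRegular (ModuleCat.of R M) x := hxreg
  exact AddCommGrpCat.subsingleton_of_isZero <| ShortComplex.Exact.isZero_of_both_zeros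
    ((Ext.covariant_sequence_exact₃' N hxreg'.smulShortComplex_shortExact) i (i + 1) rfl)
    (zero1.eq_zero_of_src _) (zero2.eq_zero_of_tgt _)

/-- If a regular sequence on `M` is longer than `dim R / I`, then `I` contains an `M`-regular
element: otherwise `I` would lie in an associated prime of `M` by prime avoidance. -/
lemma exists_mem_isSMulRegular {M : Type*} [AddCommGroup M] [Module R M] [Module.Finite R M]
    {rs : List R} (hmem : ∀ r ∈ rs, r ∈ maximalIdeal R) (hreg : IsRegular M rs) {I : Ideal R}
    (hdim : ringKrullDim (R ⧸ I) < (rs.length : WithBot ℕ∞)) :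
    ∃ x ∈ I, IsSMulRegular M x := by
  by_contra! hcon
  have hsub : (I : Set R) ⊆ ⋃ p ∈ associatedPrimes R M, (p : Set R) := by
    rw [biUnion_associatedPrimes_eq_compl_regular]
    exact fun x hx => hcon x hx
  obtain ⟨p, hp, hIp⟩ := (Ideal.subset_union_prime_finite (associatedPrimes.finite R M)
    (f := fun p => p) ⊥ ⊥ (fun p hp _ _ => hp.1)).mp hsub
  refine absurd (length_le_ringKrullDim_quotient_of_isAssociatedPrime hmem hreg hp) (not_le.mpr ?_)
  exact lt_of_le_of_lt (ringKrullDim_le_of_surjective (Ideal.Quotient.factor hIp)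
    (Ideal.Quotient.factor_surjective hIp)) hdim

/-- Over a Cohen-Macaulay local ring the annihilator of a finite module of codimension two
contains a regular sequence of length two. -/
lemma exists_regular_pair_mem_annihilator (hR : IsCohenMacaulayLocal R) (M : Type*)
    [AddCommGroup M] [Module R M] [Module.Finite R M]
    (hM : Module.supportDim R M + 2 = ringKrullDim R) :
    ∃ x ∈ Module.annihilator R M, ∃ y ∈ Module.annihilator R M,
      IsSMulRegular R x ∧ IsSMulRegular (QuotSMulTop x R) y := by
  obtain ⟨rs, hmem, hreg, hlen⟩ := hR
  have hnt : Nontrivial M := by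
    rw [← Module.supportDim_ne_bot_iff_nontrivial R]
    intro h
    rw [h, WithBot.bot_add, ← hlen] at hM
    exact WithBot.bot_ne_coe hM
  rw [← hlen, Module.supportDim_eq_ringKrullDim_quotient_annihilator] at hM
  have hnt' : Nontrivial (R ⧸ Module.annihilator R M) := by
    rw [Ideal.Quotient.nontrivial_iff]
    exact fun h => not_subsingleton M (Module.annihilator_eq_top_iff.mp h)
  obtain ⟨d, hd⟩ : ∃ d : ℕ, ringKrullDim (R ⧸ Module.annihilator R M) = d := by
    have h0 : (0 : WithBot ℕ∞) ≤ ringKrullDim (R ⧸ Module.annihilator R M) :=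
      ringKrullDim_nonneg_of_nontrivial
    generalize ringKrullDim (R ⧸ Module.annihilator R M) = e at *
    induction e with
    | bot => simp at h0
    | coe e =>
      induction e with
      | top =>
        have h1 : (⊤ + 2 : ℕ∞) = (rs.length : ℕ∞) := WithBot.coe_injective hM
        rw [top_add] at h1
        exact absurd h1.symm (ENat.natCast_ne_top _)
      | coe d => exact ⟨d, rfl⟩
  rw [hd] at hM
  have hd2 : d + 2 = rs.length := by exact_mod_cast hM
  obtain ⟨x, hx, hxreg⟩ := exists_mem_isSMulRegular hmem hreg (I := Module.annihilator R M)
    (by rw [hd]; exact_mod_cast (by omega : d < rs.length))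
  have hxm : x ∈ maximalIdeal R :=
    le_maximalIdeal (fun h => not_subsingleton M (Module.annihilator_eq_top_iff.mp h)) hx
  obtain ⟨rs', hlen', hmem', hreg'⟩ := exists_isRegular_quotSMulTop hmem hreg hxm hxreg
  obtain ⟨y, hy, hyreg⟩ := exists_mem_isSMulRegular hmem' hreg' (I := Module.annihilator R M)
    (by rw [hd]; exact_mod_cast (by omega : d < rs'.length))
  exact ⟨x, hx, y, hy, hxreg, hyreg⟩

/-- A divisibility form of regularity of `y` modulo `x`. -/
lemma IsSMulRegular.dvd_of_dvd_mul {R : Type*} [CommRing R] {x y : R}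
    (h : IsSMulRegular (QuotSMulTop x R) y) {a : R} (ha : x ∣ y * a) : x ∣ a := by
  obtain ⟨c, hc⟩ := ha
  have h0 : y • (Submodule.Quotient.mk a : QuotSMulTop x R) = y • 0 := by
    rw [smul_zero, ← Submodule.Quotient.mk_smul, Submodule.Quotient.mk_eq_zero, smul_eq_mul, hc]
    exact Submodule.smul_mem_pointwise_smul c x ⊤ trivial
  have h1 := h h0
  rw [Submodule.Quotient.mk_eq_zero] at h1
  obtain ⟨d, -, hd⟩ := (Submodule.mem_smul_pointwise_iff_exists _ _ _).mp h1
  exact ⟨d, hd.symm⟩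

end Grade

/-! ### Minimal free resolutions -/

section MinimalResolution

open IsLocalRing

/-- `d₂`, `d₁` and `ε` form a free resolution `0 ⟶ F₂ ⟶ F₁ ⟶ F₀ ⟶ M ⟶ 0` of length two over the
local ring `R` (freeness being an assumption on the modules) which is minimal, in the sense that
`d₂` and `d₁` vanish modulo the maximal ideal. -/
structure IsMinimalResolution {R : Type*} [CommRing R] [IsLocalRing R] {F₂ F₁ F₀ M : Type*}
    [AddCommGroup F₂] [Module R F₂] [AddCommGroup F₁] [Module R F₁] [AddCommGroup F₀] [Module R F₀]
    [AddCommGroup M] [Module R M] (d₂ : F₂ →ₗ[R] F₁) (d₁ : F₁ →ₗ[R] F₀) (ε : F₀ →ₗ[R] M) :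
    Prop where
  injective : Function.Injective d₂
  exact_middle : Function.Exact d₂ d₁
  exact_right : Function.Exact d₁ ε
  surjective : Function.Surjective ε
  range_two_le : LinearMap.range d₂ ≤ maximalIdeal R • ⊤
  range_one_le : LinearMap.range d₁ ≤ maximalIdeal R • ⊤

variable {R : Type u} [CommRing R] [IsLocalRing R]

/-- A finite module over a local ring has a presentation by a free module whose relations have
coefficients in the maximal ideal: lift a basis of `M / 𝔪M`. -/
lemma exists_surjective_ker_le_maximalIdeal_smul (M : Type*) [AddCommGroup M] [Module R M]
    [Module.Finite R M] : ∃ (n : ℕ) (ε : (Fin n → R) →ₗ[R] M), Function.Surjective ε ∧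
      LinearMap.ker ε ≤ maximalIdeal R • ⊤ := by
  let V := M ⧸ (maximalIdeal R • (⊤ : Submodule R M))
  let _ : Field (R ⧸ maximalIdeal R) := Ideal.Quotient.field _
  have : Module.Finite (R ⧸ maximalIdeal R) V :=
    Module.Finite.of_restrictScalars_finite R (R ⧸ maximalIdeal R) V
  let b := Module.finBasis (R ⧸ maximalIdeal R) V
  choose g hg using fun i => Submodule.mkQ_surjective _ (b i)
  let ε := Fintype.linearCombination R g
  have hε : ∀ r, (Submodule.mkQ _ (ε r) : V) =
      ∑ i, Ideal.Quotient.mk (maximalIdeal R) (r i) • b i := by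
    intro r
    simp only [ε, Fintype.linearCombination_apply, map_sum, map_smul, hg]
    rfl
  refine ⟨_, ε, LinearMap.surjective_of_surjective_comp_mkQ ε (maximalIdeal R)
    (by rw [jacobson_eq_maximalIdeal _ bot_ne_top]) fun v => ?_, fun r hr => ?_⟩
  · choose c hc using fun i => Ideal.Quotient.mk_surjective (b.repr v i)
    refine ⟨c, ?_⟩
    rw [LinearMap.comp_apply, hε]
    simp only [hc]
    exact b.sum_repr v
  · have h0 : ∑ i, Ideal.Quotient.mk (maximalIdeal R) (r i) • b i = 0 := by
      rw [← hε, LinearMap.mem_ker.mp hr, map_zero]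
    have h1 := Fintype.linearIndependent_iff.mp b.linearIndependent _ h0
    rw [pi_eq_sum_univ r]
    exact Submodule.sum_mem _ fun i _ => Submodule.smul_mem_smul
      (Ideal.Quotient.eq_zero_iff_mem.mp (h1 i)) trivial

/-- The syzygies of a finite module of projective dimension at most two yield a minimal free
resolution of length two. -/
lemma exists_isMinimalResolution [IsNoetherianRing R] (M : Type u) [AddCommGroup M] [Module R M]
    [Module.Finite R M] (hpd : HasProjectiveDimensionLE (ModuleCat.of R M) 2) :
    ∃ (n m : ℕ) (F₂ : Type u) (_ : AddCommGroup F₂) (_ : Module R F₂) (_ : Module.Free R F₂)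
      (_ : Module.Finite R F₂) (d₂ : F₂ →ₗ[R] (Fin m → R)) (d₁ : (Fin m → R) →ₗ[R] (Fin n → R))
      (ε : (Fin n → R) →ₗ[R] M), IsMinimalResolution d₂ d₁ ε := by
  obtain ⟨n, ε, hε, hεm⟩ := exists_surjective_ker_le_maximalIdeal_smul (R := R) M
  obtain ⟨m, π, hπ, hπm⟩ := exists_surjective_ker_le_maximalIdeal_smul (R := R) (LinearMap.ker ε)
  have h1 := LinearMap.shortExact_shortComplexKer hε
  have h2 := LinearMap.shortExact_shortComplexKer hπ
  have hp : ∀ k, Projective (ModuleCat.of R (Fin k → R)) := fun k =>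
    (IsProjective.iff_projective _).mp inferInstance
  have e1 : HasProjectiveDimensionLT (ModuleCat.of R (LinearMap.ker ε)) 2 :=
    (h1.hasProjectiveDimensionLT_X₃_iff 1 (hp n)).mp hpd
  have e2 : HasProjectiveDimensionLT (ModuleCat.of R (LinearMap.ker π)) 1 :=
    (h2.hasProjectiveDimensionLT_X₃_iff 0 (hp m)).mp e1
  have : Module.Projective R (LinearMap.ker π) :=
    (IsProjective.iff_projective _).mpr (inferInstanceAs
      (Projective (ModuleCat.of R (LinearMap.ker π))))
  have : Module.Free R (LinearMap.ker π) := Module.free_of_flat_of_isLocalRing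
  refine ⟨n, m, LinearMap.ker π, inferInstance, inferInstance, inferInstance, inferInstance,
    (LinearMap.ker π).subtype, (LinearMap.ker ε).subtype ∘ₗ π, ε, Subtype.val_injective, ?_, ?_,
    hε, ?_, ?_⟩
  · intro f
    simp
  · intro f
    constructor
    · intro hf
      obtain ⟨g, hg⟩ := hπ ⟨f, hf⟩
      exact ⟨g, by simp [hg]⟩
    · rintro ⟨g, rfl⟩
      exact (π g).2
  · rw [Submodule.range_subtype]
    exact hπm
  · rw [LinearMap.range_comp]
    exact (Submodule.map_subtype_le _ _).trans hεm

end MinimalResolution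

/-! ### Second Ext modules from a resolution -/

section ExtTwo

variable {R : Type u} [CommRing R] {F₂ F₁ F₀ M : Type u}
  [AddCommGroup F₂] [Module R F₂] [AddCommGroup F₁] [Module R F₁] [AddCommGroup F₀] [Module R F₀]
  [AddCommGroup M] [Module R M]

/-- For a projective resolution `0 ⟶ F₂ ⟶ F₁ ⟶ F₀ ⟶ M ⟶ 0`, every class in `Ext²(M, N)` comes from
a linear form `F₂ → N`, unique up to forms that extend to `F₁`, and precomposition with an
endomorphism `g` of `M` is computed by a lift of `g` to the resolution. The map is the Yoneda
product with the two short exact sequences into which the resolution breaks up. -/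
lemma exists_addMonoidHom_ext_two (N : Type u) [AddCommGroup N] [Module R N]
    [Module.Projective R F₁] [Module.Projective R F₀] {d₂ : F₂ →ₗ[R] F₁} {d₁ : F₁ →ₗ[R] F₀}
    {ε : F₀ →ₗ[R] M} (hinj : Function.Injective d₂) (hmid : Function.Exact d₂ d₁)
    (hright : Function.Exact d₁ ε) (hsurj : Function.Surjective ε) :
    ∃ cl : (F₂ →ₗ[R] N) →+ Ext.{u} (ModuleCat.of R M) (ModuleCat.of R N) 2,
      Function.Surjective cl ∧ (∀ u, cl u = 0 ↔ ∃ w : F₁ →ₗ[R] N, w ∘ₗ d₂ = u) ∧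
      ∀ (g : M →ₗ[R] M) (f₂ : F₂ →ₗ[R] F₂) (f₁ : F₁ →ₗ[R] F₁) (f₀ : F₀ →ₗ[R] F₀),
        d₂ ∘ₗ f₂ = f₁ ∘ₗ d₂ → d₁ ∘ₗ f₁ = f₀ ∘ₗ d₁ → ε ∘ₗ f₀ = g ∘ₗ ε → ∀ u,
          cl (u ∘ₗ f₂) = (Ext.mk₀ (ModuleCat.ofHom g)).comp (cl u) (zero_add 2) := by
  let π : F₁ →ₗ[R] LinearMap.ker ε := d₁.codRestrict _ fun f => (hright (d₁ f)).mpr ⟨f, rfl⟩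
  have hπd : π ∘ₗ d₂ = 0 := by
    ext f
    exact (hmid (d₂ f)).mpr ⟨f, rfl⟩
  let S₁ := ε.shortComplexKer
  have h₁ : S₁.ShortExact := LinearMap.shortExact_shortComplexKer hsurj
  let S₂ := ModuleCat.shortComplexOfCompEqZero d₂ π hπd
  have h₂ : S₂.ShortExact := by
    refine ModuleCat.shortComplex_shortExact S₂ (fun f => ?_) hinj fun k => ?_
    · exact Subtype.ext_iff.trans (hmid f)
    · obtain ⟨f, hf⟩ := (hright k.1).mp k.2
      exact ⟨f, Subtype.ext hf⟩
  have hp₁ : Projective S₂.X₂ := (IsProjective.iff_projective F₁).mp inferInstance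
  have hp₀ : Projective S₁.X₂ := (IsProjective.iff_projective F₀).mp inferInstance
  let Y := ModuleCat.of R N
  let cl : (F₂ →ₗ[R] N) →+ Ext.{u} (ModuleCat.of R M) Y 2 :=
    { toFun := fun u => h₁.extClass.comp
        (h₂.extClass.comp (Ext.mk₀ (ModuleCat.ofHom u : S₂.X₁ ⟶ Y)) (add_zero 1)) rfl
      map_zero' := by
        change h₁.extClass.comp (h₂.extClass.comp (Ext.mk₀ (0 : S₂.X₁ ⟶ Y)) _) _ = 0
        simp
      map_add' := fun u v => by
        change h₁.extClass.comp (h₂.extClass.comp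
          (Ext.mk₀ ((ModuleCat.ofHom u : S₂.X₁ ⟶ Y) + ModuleCat.ofHom v)) _) _ = _
        simp [Ext.mk₀_add] }
  refine ⟨cl, fun x => ?_, fun u => ⟨fun hu => ?_, ?_⟩, fun g f₂ f₁ f₀ c₂ c₁ c₀ u => ?_⟩
  · obtain ⟨x₁, hx₁⟩ := Ext.contravariant_sequence_exact₃ h₁ Y x
      (Ext.eq_zero_of_projective _) (rfl : 1 + 1 = 2)
    obtain ⟨x₀, hx₀⟩ := Ext.contravariant_sequence_exact₃ h₂ Y x₁
      (Ext.eq_zero_of_projective _) (add_zero 1)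
    obtain ⟨u, rfl⟩ := Ext.addEquiv₀.symm.surjective x₀
    refine ⟨u.hom, ?_⟩
    rw [← hx₁, ← hx₀]
    rfl
  · obtain ⟨x₂, hx₂⟩ := Ext.contravariant_sequence_exact₁ h₁ Y _ (rfl : 1 + 1 = 2) hu
    rw [Ext.eq_zero_of_projective x₂, Ext.comp_zero] at hx₂
    obtain ⟨w, hw⟩ := Ext.contravariant_sequence_exact₁ h₂ Y _ (add_zero 1) hx₂.symm
    obtain ⟨w, rfl⟩ := Ext.addEquiv₀.symm.surjective w
    refine ⟨w.hom, ?_⟩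
    rw [Ext.addEquiv₀_symm_apply, Ext.mk₀_comp_mk₀] at hw
    have := (Ext.mk₀_bijective _ _).1 hw
    exact congrArg ModuleCat.Hom.hom this
  · rintro ⟨w, rfl⟩
    have h0 : h₂.extClass.comp (Ext.mk₀ (S₂.f ≫ (ModuleCat.ofHom w : S₂.X₂ ⟶ Y)))
        (add_zero 1) = 0 := by
      rw [← Ext.mk₀_comp_mk₀]
      exact h₂.extClass_comp_assoc _
    change h₁.extClass.comp (h₂.extClass.comp
      (Ext.mk₀ (S₂.f ≫ (ModuleCat.ofHom w : S₂.X₂ ⟶ Y))) (add_zero 1)) (rfl : 1 + 1 = 2) = 0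
    rw [h0, Ext.comp_zero]
  · have hK : ∀ k ∈ LinearMap.ker ε, f₀ k ∈ LinearMap.ker ε := fun k hk => by
      rw [LinearMap.mem_ker] at hk ⊢
      rw [← LinearMap.comp_apply, c₀, LinearMap.comp_apply, hk, map_zero]
    let fK : LinearMap.ker ε →ₗ[R] LinearMap.ker ε := f₀.restrict hK
    let φ₁ : S₁ ⟶ S₁ :=
      { τ₁ := ModuleCat.ofHom fK
        τ₂ := ModuleCat.ofHom f₀
        τ₃ := ModuleCat.ofHom g
        comm₁₂ := by ext; rfl
        comm₂₃ := by
          ext k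
          exact (LinearMap.congr_fun c₀ k) }
    let φ₂ : S₂ ⟶ S₂ :=
      { τ₁ := ModuleCat.ofHom f₂
        τ₂ := ModuleCat.ofHom f₁
        τ₃ := ModuleCat.ofHom fK
        comm₁₂ := by
          ext k
          exact LinearMap.congr_fun c₂ k
        comm₂₃ := by
          ext k
          exact LinearMap.congr_fun c₁ k }
    have n₁ := ShortComplex.ShortExact.extClass_naturality h₁ h₁ φ₁
    have n₂ := ShortComplex.ShortExact.extClass_naturality h₂ h₂ φ₂
    change h₁.extClass.comp (h₂.extClass.comp
      (Ext.mk₀ (φ₂.τ₁ ≫ (ModuleCat.ofHom u : S₂.X₁ ⟶ Y))) (add_zero 1)) (rfl : 1 + 1 = 2) =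
      (Ext.mk₀ φ₁.τ₃).comp (h₁.extClass.comp (h₂.extClass.comp
        (Ext.mk₀ (ModuleCat.ofHom u : S₂.X₁ ⟶ Y)) (add_zero 1)) (rfl : 1 + 1 = 2)) (zero_add 2)
    rw [← Ext.mk₀_comp_mk₀, ← Ext.comp_assoc h₂.extClass _ _ (add_zero 1) (zero_add 0) rfl, n₂,
      Ext.comp_assoc (Ext.mk₀ φ₂.τ₃) _ _ (zero_add 1) (add_zero 1) rfl,
      ← Ext.comp_assoc h₁.extClass _ _ (add_zero 1) (zero_add 1) rfl]
    rw [show φ₂.τ₃ = φ₁.τ₁ from rfl, n₁, Ext.comp_assoc _ _ _ (zero_add 1) _ rfl]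

end ExtTwo

/-! ### Multiplication on a resolution -/

section Products

/-- Bilinear maps on projective modules lift along exact sequences. -/
lemma exists_bilinear_lift {R P Q L M N : Type*} [CommRing R] [AddCommGroup P] [Module R P]
    [AddCommGroup Q] [Module R Q] [AddCommGroup L] [Module R L] [AddCommGroup M] [Module R M]
    [AddCommGroup N] [Module R N] [Module.Projective R P] [Module.Projective R Q]
    {f : L →ₗ[R] M} {g : M →ₗ[R] N} (hfg : Function.Exact f g) (B : P →ₗ[R] Q →ₗ[R] M)
    (hB : ∀ p q, g (B p q) = 0) : ∃ C : P →ₗ[R] Q →ₗ[R] L, ∀ p q, f (C p q) = B p q := by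
  have hB' : ∀ t, g (TensorProduct.lift B t) = 0 := by
    intro t
    induction t with
    | zero => simp
    | tmul p q => simpa using hB p q
    | add a b ha hb => rw [map_add, map_add, ha, hb, add_zero]
  obtain ⟨h, hh⟩ := Module.projective_lifting_property (f.codRestrict (LinearMap.ker g)
    fun l => (hfg _).mpr ⟨l, rfl⟩) ((TensorProduct.lift B).codRestrict (LinearMap.ker g) hB')
    (fun k => by
      obtain ⟨l, hl⟩ := (hfg _).mp k.2
      exact ⟨l, Subtype.ext hl⟩)
  refine ⟨TensorProduct.curry h, fun p q => ?_⟩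
  exact (congrArg Subtype.val (LinearMap.congr_fun hh (p ⊗ₜ q))).trans (TensorProduct.lift.tmul p q)

variable {R : Type*} [CommRing R] {F₂ F₁ F₀ A : Type*}
  [AddCommGroup F₂] [Module R F₂] [AddCommGroup F₁] [Module R F₁] [AddCommGroup F₀] [Module R F₀]
  [CommRing A] [Algebra R A] [Module.Projective R F₂] [Module.Projective R F₁]
  [Module.Projective R F₀]

/-- A projective resolution of length two of a commutative algebra carries a multiplication
`Fᵢ × Fⱼ → Fᵢ₊ⱼ` that satisfies the Leibniz rule and is alternating on `F₁`; multiplication by an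
element of `F₀` lifts a multiplication of the algebra to the resolution. The product on `F₀` is made
symmetric by averaging; the alternation on `F₁` then follows as `d₂` is injective. -/
lemma exists_resolution_products (h2 : IsUnit (2 : R)) {d₂ : F₂ →ₗ[R] F₁} {d₁ : F₁ →ₗ[R] F₀}
    {ε : F₀ →ₗ[R] A} (hinj : Function.Injective d₂) (hmid : Function.Exact d₂ d₁)
    (hright : Function.Exact d₁ ε) (hsurj : Function.Surjective ε) :
    ∃ (μ₁₁ : F₁ →ₗ[R] F₁ →ₗ[R] F₂) (μ₀₂ : F₀ →ₗ[R] F₂ →ₗ[R] F₂),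
      (∀ f, μ₁₁ f f = 0) ∧ (∀ f h, μ₁₁ f (d₂ h) = μ₀₂ (d₁ f) h) ∧
      ∀ a, ∃ (f₁ : F₁ →ₗ[R] F₁) (f₀ : F₀ →ₗ[R] F₀), d₂ ∘ₗ μ₀₂ a = f₁ ∘ₗ d₂ ∧
        d₁ ∘ₗ f₁ = f₀ ∘ₗ d₁ ∧ ε ∘ₗ f₀ = LinearMap.mulLeft R (ε a) ∘ₗ ε := by
  obtain ⟨c, hc⟩ := h2.exists_left_inv
  have hεd : ∀ f, ε (d₁ f) = 0 := fun f => (hright _).mpr ⟨f, rfl⟩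
  have hdd : ∀ f, d₁ (d₂ f) = 0 := fun f => (hmid _).mpr ⟨f, rfl⟩
  have hzero : Function.Exact ε (0 : A →ₗ[R] A) := fun a => by simpa using hsurj a
  obtain ⟨B, hB⟩ := exists_bilinear_lift hzero ((LinearMap.mul R A).compl₁₂ ε ε) (by simp)
  let μ₀₀ : F₀ →ₗ[R] F₀ →ₗ[R] F₀ := c • (B + B.flip)
  have hsymm : ∀ a b, μ₀₀ a b = μ₀₀ b a := fun a b => by simp [μ₀₀, add_comm]
  have hμ₀₀ : ∀ a b, ε (μ₀₀ a b) = ε a * ε b := fun a b => by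
    simp only [μ₀₀, LinearMap.smul_apply, LinearMap.add_apply, LinearMap.flip_apply, map_smul,
      map_add, hB, LinearMap.compl₁₂_apply, LinearMap.mul_apply']
    rw [mul_comm (ε b), ← two_smul R, smul_smul, hc, one_smul]
  obtain ⟨μ₀₁, hμ₀₁⟩ := exists_bilinear_lift hright (μ₀₀.compl₁₂ LinearMap.id d₁)
    (fun a f => by simp [hμ₀₀, hεd])
  have hμ₀₁' : ∀ a f, d₁ (μ₀₁ a f) = μ₀₀ a (d₁ f) := hμ₀₁
  obtain ⟨μ₁₁, hμ₁₁⟩ := exists_bilinear_lift hmid (μ₀₁.compl₁₂ d₁ LinearMap.id -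
    (μ₀₁.compl₁₂ d₁ LinearMap.id).flip) (fun f g => by simp [hμ₀₁', hsymm (d₁ f)])
  have hμ₁₁' : ∀ f g, d₂ (μ₁₁ f g) = μ₀₁ (d₁ f) g - μ₀₁ (d₁ g) f := hμ₁₁
  obtain ⟨μ₀₂, hμ₀₂⟩ := exists_bilinear_lift hmid (μ₀₁.compl₁₂ LinearMap.id d₂)
    (fun a f => by simp [hμ₀₁', hdd])
  have hμ₀₂' : ∀ a h, d₂ (μ₀₂ a h) = μ₀₁ a (d₂ h) := hμ₀₂
  refine ⟨μ₁₁, μ₀₂, fun f => hinj ?_, fun f h => hinj ?_, fun a => ⟨μ₀₁ a, μ₀₀ a, ?_, ?_, ?_⟩⟩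
  · rw [hμ₁₁', sub_self, map_zero]
  · rw [hμ₁₁', hμ₀₂', hdd, map_zero, LinearMap.zero_apply, sub_zero]
  · ext h
    exact hμ₀₂' a h
  · ext f
    exact hμ₀₁' a f
  · ext b
    exact hμ₀₀ a b

end Products

/-! ### Duality -/

section Duality

open IsLocalRing

/-- If `x` and `y` kill `M` and form a regular sequence on `R`, then `Ext¹(M, R) = 0`, in the form:
a linear form on `F₁` that vanishes on the relations `ker d₁` extends along `d₁ : F₁ → F₀`. The
extension sends `v` to `g (x v) / x`, where `g` is the induced form on the image of `d₁`. -/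
lemma exists_comp_eq_of_vanishes_on_ker {R F₁ F₀ M : Type*} [CommRing R] [AddCommGroup F₁]
    [Module R F₁] [AddCommGroup F₀] [Module R F₀] [AddCommGroup M] [Module R M]
    {d₁ : F₁ →ₗ[R] F₀} {ε : F₀ →ₗ[R] M} (hright : Function.Exact d₁ ε) {x y : R}
    (hx : x ∈ Module.annihilator R M) (hy : y ∈ Module.annihilator R M) (hxreg : IsSMulRegular R x)
    (hyreg : IsSMulRegular (QuotSMulTop x R) y) (w : F₁ →ₗ[R] R)
    (hw : ∀ f, d₁ f = 0 → w f = 0) : ∃ v : F₀ →ₗ[R] R, v ∘ₗ d₁ = w := by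
  have hw' : ∀ f g, d₁ f = d₁ g → w f = w g := fun f g h => by
    rw [← sub_eq_zero, ← map_sub]
    exact hw _ (by rw [map_sub, h, sub_self])
  have hlift : ∀ r ∈ Module.annihilator R M, ∀ v, ∃ f, d₁ f = r • v := fun r hr v => by
    refine (hright _).mp ?_
    rw [map_smul]
    exact Module.mem_annihilator.mp hr _
  choose p hp using hlift x hx
  choose q hq using hlift y hy
  have hdiv : ∀ v, x ∣ w (p v) := fun v => by
    refine hyreg.dvd_of_dvd_mul ⟨w (q v), ?_⟩
    rw [← smul_eq_mul, ← smul_eq_mul, ← map_smul, ← map_smul]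
    refine hw' _ _ ?_
    rw [map_smul, map_smul, hp, hq, smul_comm]
  choose v hv using hdiv
  refine ⟨{ toFun := v, map_add' := fun a b => hxreg ?_, map_smul' := fun c a => hxreg ?_ }, ?_⟩
  · simp only [smul_eq_mul, mul_add, ← hv]
    rw [← map_add]
    refine hw' _ _ ?_
    rw [map_add, hp, hp, hp, smul_add]
  · simp only [smul_eq_mul, RingHom.id_apply]
    rw [mul_left_comm, ← hv, ← hv, ← smul_eq_mul, ← map_smul]
    refine hw' _ _ ?_
    rw [map_smul, hp, hp, smul_comm]
  · ext f
    refine hxreg ?_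
    change x * v (d₁ f) = x • w f
    rw [← hv, ← map_smul]
    refine hw' _ _ ?_
    rw [hp, map_smul]

lemma Module.Dual.mem_smul_top_of_forall_mem {R F : Type*} [CommRing R] [AddCommGroup F]
    [Module R F] [Module.Free R F] [Module.Finite R F] {I : Ideal R} {w : Module.Dual R F}
    (hw : ∀ f, w f ∈ I) : w ∈ I • (⊤ : Submodule R (Module.Dual R F)) := by
  let b := Module.Free.chooseBasis R F
  have : w = ∑ i, w (b i) • b.coord i := b.ext fun j => by
    simp
  rw [this]
  exact Submodule.sum_mem _ fun i _ => Submodule.smul_mem_smul (hw _) trivial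

lemma Module.Dual.comp_mem_smul_top {R F G : Type*} [CommRing R] [AddCommGroup F]
    [Module R F] [Module.Free R F] [Module.Finite R F] [AddCommGroup G] [Module R G] {I : Ideal R}
    {d : F →ₗ[R] G} (hd : LinearMap.range d ≤ I • ⊤) (w : Module.Dual R G) :
    w ∘ₗ d ∈ I • (⊤ : Submodule R (Module.Dual R F)) := by
  refine Module.Dual.mem_smul_top_of_forall_mem fun f => ?_
  have h1 : w (d f) ∈ (I • (⊤ : Submodule R G)).map w :=
    Submodule.mem_map_of_mem (hd ⟨f, rfl⟩)
  rw [Submodule.map_smul''] at h1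
  have h2 : w (d f) ∈ I • (⊤ : Submodule R R) := Submodule.smul_mono le_rfl le_top h1
  simpa using h2

variable {R : Type u} [CommRing R] [IsLocalRing R]

lemma LinearMap.surjective_of_forall_sub_mem {P Q : Type*} [AddCommGroup P] [Module R P]
    [AddCommGroup Q] [Module R Q] [Module.Finite R Q] (f : P →ₗ[R] Q)
    (h : ∀ q, ∃ p, q - f p ∈ maximalIdeal R • (⊤ : Submodule R Q)) : Function.Surjective f := by
  refine LinearMap.surjective_of_surjective_comp_mkQ f (maximalIdeal R)
    (by rw [jacobson_eq_maximalIdeal _ bot_ne_top]) fun z => ?_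
  obtain ⟨q, rfl⟩ := Submodule.mkQ_surjective _ z
  obtain ⟨p, hp⟩ := h q
  refine ⟨p, ?_⟩
  rw [LinearMap.comp_apply, eq_comm, ← sub_eq_zero, ← map_sub]
  exact (Submodule.Quotient.mk_eq_zero _).mpr hp

/-- A surjection onto a projective module whose kernel lies in `𝔪P` is injective, as the kernel is
a direct summand. -/
lemma LinearMap.injective_of_ker_le_maximalIdeal_smul [IsNoetherianRing R] {P Q : Type*}
    [AddCommGroup P] [Module R P] [Module.Finite R P] [AddCommGroup Q] [Module R Q]
    [Module.Projective R Q] (f : P →ₗ[R] Q) (hf : Function.Surjective f)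
    (hker : LinearMap.ker f ≤ maximalIdeal R • ⊤) : Function.Injective f := by
  obtain ⟨s, hs⟩ := Module.projective_lifting_property f LinearMap.id hf
  have hs' : ∀ q, f (s q) = q := LinearMap.congr_fun hs
  let t : P →ₗ[R] P := LinearMap.id - s ∘ₗ f
  have hker' : LinearMap.ker f ≤ maximalIdeal R • LinearMap.ker f := by
    intro k hk
    have h1 : t k ∈ (maximalIdeal R • (⊤ : Submodule R P)).map t :=
      Submodule.mem_map_of_mem (hker hk)
    rw [Submodule.map_smul''] at h1
    have h2 : t k = k := by simp [t, LinearMap.mem_ker.mp hk]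
    rw [h2] at h1
    refine Submodule.smul_mono le_rfl ?_ h1
    rintro _ ⟨z, -, rfl⟩
    simp [t, hs']
  rw [← LinearMap.ker_eq_bot]
  exact Submodule.eq_bot_of_le_smul_of_le_jacobson_bot _ _ (IsNoetherian.noetherian _) hker'
    (by rw [jacobson_eq_maximalIdeal _ bot_ne_top])

/-- Duality for a Gorenstein algebra of codimension two: the middle module of a minimal free
resolution carries a perfect alternating form `Φ₁` and the outer modules are in perfect duality
via `Φ₀`, in such a way that the two differentials are adjoint. Both pairings are the product on the
resolution followed by a form `u : F₂ → R` whose class corresponds to `1 : A`. -/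
lemma exists_perfect_pairings [IsNoetherianRing R] {F₂ F₁ F₀ A : Type u} [AddCommGroup F₂]
    [Module R F₂] [AddCommGroup F₁] [Module R F₁] [AddCommGroup F₀] [Module R F₀] [CommRing A]
    [Algebra R A] [Module.Free R F₂] [Module.Free R F₁] [Module.Free R F₀] [Module.Finite R F₂]
    [Module.Finite R F₁] [Module.Finite R F₀] (h2 : IsUnit (2 : R)) {d₂ : F₂ →ₗ[R] F₁}
    {d₁ : F₁ →ₗ[R] F₀} {ε : F₀ →ₗ[R] A} (hres : IsMinimalResolution d₂ d₁ ε)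
    (e : A ≃+ Ext.{u} (ModuleCat.of R A) (ModuleCat.of R R) 2)
    (he : ∀ a x : A, e (a * x) = (Ext.mk₀ (mulEnd R A a)).comp (e x) (zero_add 2)) {x y : R}
    (hx : x ∈ Module.annihilator R A) (hy : y ∈ Module.annihilator R A) (hxreg : IsSMulRegular R x)
    (hyreg : IsSMulRegular (QuotSMulTop x R) y) :
    ∃ (Φ₁ : F₁ →ₗ[R] Module.Dual R F₁) (Φ₀ : F₀ →ₗ[R] Module.Dual R F₂), (∀ f, Φ₁ f f = 0) ∧
      (∀ f h, Φ₁ f (d₂ h) = Φ₀ (d₁ f) h) ∧ Function.Bijective Φ₁ ∧ Function.Bijective Φ₀ := by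
  obtain ⟨cl, hsurj, hker, hnat⟩ := exists_addMonoidHom_ext_two R hres.injective
    hres.exact_middle hres.exact_right hres.surjective
  obtain ⟨μ₁₁, μ₀₂, halt, hleib, hchain⟩ := exists_resolution_products h2 hres.injective
    hres.exact_middle hres.exact_right hres.surjective
  obtain ⟨u, hu⟩ := hsurj (e 1)
  let Φ₁ : F₁ →ₗ[R] Module.Dual R F₁ := μ₁₁.compr₂ u
  let Φ₀ : F₀ →ₗ[R] Module.Dual R F₂ := μ₀₂.compr₂ u
  have hΦ₀ : ∀ a, cl (Φ₀ a) = e (ε a) := fun a => by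
    obtain ⟨f₁, f₀, c₂, c₁, c₀⟩ := hchain a
    have := hnat _ _ _ _ c₂ c₁ c₀ u
    rw [hu] at this
    rw [← mul_one (ε a), he]
    exact this
  have hcomp : ∀ f h, Φ₁ f (d₂ h) = Φ₀ (d₁ f) h := fun f h => congrArg u (hleib f h)
  have hsurj₀ : Function.Surjective Φ₀ := LinearMap.surjective_of_forall_sub_mem _ fun q => by
    obtain ⟨a, ha⟩ := hres.surjective (e.symm (cl q))
    refine ⟨a, ?_⟩
    obtain ⟨w, hw⟩ := (hker (q - Φ₀ a)).mp (by rw [map_sub, hΦ₀, ha, e.apply_symm_apply, sub_self])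
    rw [← hw]
    exact Module.Dual.comp_mem_smul_top hres.range_two_le w
  have hε : ∀ a, cl (Φ₀ a) = 0 → ∃ f, d₁ f = a := fun a ha => by
    rw [hΦ₀, e.map_eq_zero_iff] at ha
    exact (hres.exact_right a).mp ha
  have hinj₀ : Function.Injective Φ₀ := LinearMap.injective_of_ker_le_maximalIdeal_smul _ hsurj₀
    fun a ha => hres.range_one_le (hε a (by rw [LinearMap.mem_ker.mp ha, map_zero]))
  have hsurj₁ : Function.Surjective Φ₁ := LinearMap.surjective_of_forall_sub_mem _ fun w => by
    obtain ⟨a, ha⟩ := hsurj₀ (w ∘ₗ d₂)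
    obtain ⟨f, rfl⟩ := hε a ((hker _).mpr ⟨w, ha.symm⟩)
    refine ⟨f, ?_⟩
    obtain ⟨v, hv⟩ := exists_comp_eq_of_vanishes_on_ker hres.exact_right hx hy hxreg hyreg
      (w - Φ₁ f) fun g hg => by
        obtain ⟨h, rfl⟩ := (hres.exact_middle g).mp hg
        rw [LinearMap.sub_apply, hcomp, ha, LinearMap.comp_apply, sub_self]
    rw [← hv]
    exact Module.Dual.comp_mem_smul_top hres.range_one_le v
  -- a surjection between finite free modules of the same finite rank is bijective
  have hinj₁ : Function.Injective Φ₁ := by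
    let b := Module.Free.chooseBasis R F₁
    have := OrzechProperty.injective_of_surjective_endomorphism
      (b.toDualEquiv.symm.toLinearMap ∘ₗ Φ₁) (b.toDualEquiv.symm.surjective.comp hsurj₁)
    exact Function.Injective.of_comp this
  exact ⟨Φ₁, Φ₀, fun f => by simp [Φ₁, halt], hcomp, ⟨hinj₁, hsurj₁⟩, ⟨hinj₀, hsurj₀⟩⟩

end Duality

/-! ### Ranks -/

section Ranks

open TensorProduct

/-- In a free resolution of length two of a module killed by a regular element `x`, the middle rank
is the sum of the outer ranks: inverting `x` turns the resolution into a short exact sequence. -/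
lemma finrank_eq_add_of_annihilated {R F₂ F₁ F₀ M : Type u} [CommRing R] [Nontrivial R]
    [AddCommGroup F₂] [Module R F₂] [AddCommGroup F₁] [Module R F₁] [AddCommGroup F₀] [Module R F₀]
    [AddCommGroup M] [Module R M] [Module.Free R F₂] [Module.Free R F₁] [Module.Free R F₀]
    [Module.Finite R F₂] [Module.Finite R F₁] [Module.Finite R F₀] {d₂ : F₂ →ₗ[R] F₁}
    {d₁ : F₁ →ₗ[R] F₀} {ε : F₀ →ₗ[R] M} (hinj : Function.Injective d₂)
    (hmid : Function.Exact d₂ d₁) (hright : Function.Exact d₁ ε) {x : R}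
    (hx : x ∈ Module.annihilator R M) (hxreg : IsSMulRegular R x) :
    Module.finrank R F₁ = Module.finrank R F₂ + Module.finrank R F₀ := by
  let L := Localization.Away x
  have : Nontrivial L := by
    refine (IsLocalization.injective L (M := Submonoid.powers x) ?_).nontrivial
    rintro _ ⟨k, rfl⟩
    rw [mem_nonZeroDivisors_iff_right]
    intro z hz
    refine (hxreg.pow k) ?_
    simpa [mul_comm] using hz
  have hu : IsUnit (algebraMap R L x) := IsLocalization.Away.algebraMap_isUnit x
  let D₂ := d₂.baseChange L
  let D₁ := d₁.baseChange L
  have hD₂ : Function.Injective D₂ := Module.Flat.lTensor_preserves_injective_linearMap d₂ hinj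
  have hex : Function.Exact D₂ D₁ := Module.Flat.lTensor_exact L hmid
  have hD₁ : Function.Surjective D₁ := by
    rw [← LinearMap.range_eq_top, eq_top_iff]
    rintro z -
    induction z with
    | zero => exact zero_mem _
    | add a b ha hb => exact add_mem ha hb
    | tmul l v =>
      obtain ⟨f, hf⟩ := (hright (x • v)).mp (by
        rw [map_smul]
        exact Module.mem_annihilator.mp hx _)
      obtain ⟨c, hc⟩ := hu.exists_left_inv
      refine ⟨(c * l) ⊗ₜ f, ?_⟩
      rw [LinearMap.baseChange_tmul, hf, ← TensorProduct.smul_tmul, Algebra.smul_def,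
        ← mul_assoc, mul_comm _ c, hc, one_mul]
  let S := ModuleCat.shortComplexOfCompEqZero D₂ D₁ hex.linearMap_comp_eq_zero
  have hS : S.ShortExact := ModuleCat.shortComplex_shortExact S hex hD₂ hD₁
  have h2 : Module.Free L S.X₁ := inferInstanceAs (Module.Free L (L ⊗[R] F₂))
  have h0 : Module.Free L S.X₃ := inferInstanceAs (Module.Free L (L ⊗[R] F₀))
  have h2' : Module.Finite L S.X₁ := inferInstanceAs (Module.Finite L (L ⊗[R] F₂))
  have h0' : Module.Finite L S.X₃ := inferInstanceAs (Module.Finite L (L ⊗[R] F₀))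
  have := ModuleCat.free_shortExact_finrank_add hS (Module.finrank_baseChange (R := L) (S := R)
    (M' := F₂)) (Module.finrank_baseChange (R := L) (S := R) (M' := F₀))
  rw [← this]
  exact (Module.finrank_baseChange (R := L) (S := R) (M' := F₁)).symm

end Ranks

/-! ### Symplectic bases -/

section Symplectic

/-- A perfect alternating form on a finite free module over a local ring has a symplectic basis. The
hyperbolic plane through a basis vector splits off orthogonally. -/
lemma exists_symplectic_basis {R : Type*} [CommRing R] [IsLocalRing R] {V : Type*} [AddCommGroup V]
    [Module R V] [Module.Free R V] [Module.Finite R V] (ω : V →ₗ[R] Module.Dual R V)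
    (halt : ∀ v, ω v v = 0) (hbij : Function.Bijective ω) :
    ∃ (ι : Type) (_ : Fintype ι) (b : Module.Basis (ι ⊕ ι) R V),
      (∀ i j, ω (b (.inl i)) (b (.inl j)) = 0) ∧ (∀ i j, ω (b (.inr i)) (b (.inr j)) = 0) ∧
      (∀ i, ω (b (.inl i)) (b (.inr i)) = 1) ∧
      (∀ i j, i ≠ j → ω (b (.inl i)) (b (.inr j)) = 0) := by
  obtain ⟨N, hN⟩ : ∃ N, Module.finrank R V = N := ⟨_, rfl⟩
  induction N using Nat.strong_induction_on generalizing V with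
  | _ N ih =>
  have hskew : ∀ v w, ω v w = -ω w v := fun v w => by
    have h := halt (v + w)
    simp only [map_add, LinearMap.add_apply, halt, zero_add, add_zero] at h
    exact eq_neg_of_add_eq_zero_right h
  rcases subsingleton_or_nontrivial V with hV | hV
  · exact ⟨Empty, inferInstance, Module.Basis.empty V, by simp, by simp, by simp, by simp⟩
  obtain ⟨i₀⟩ := (Module.Free.chooseBasis R V).index_nonempty
  obtain ⟨e, f, hef⟩ : ∃ e f, ω e f = 1 := by
    obtain ⟨e, he⟩ := hbij.2 ((Module.Free.chooseBasis R V).coord i₀)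
    exact ⟨e, Module.Free.chooseBasis R V i₀, by rw [he]; simp⟩
  have hfe : ω f e = -1 := by rw [hskew, hef]
  let W : Submodule R V := LinearMap.ker (ω e) ⊓ LinearMap.ker (ω f)
  have hW : ∀ w : W, ω e w = 0 ∧ ω f w = 0 := fun w => w.2
  have hW' : ∀ w : W, ω w e = 0 ∧ ω w f = 0 := fun w => by
    rw [hskew, hskew w.1 f, (hW w).1, (hW w).2]
    simp
  let P : V →ₗ[R] W := (LinearMap.id + (ω f).smulRight e - (ω e).smulRight f).codRestrict W
    fun v => by
      constructor
      · simp [halt, hef]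
      · simp [halt, hfe]
  have hP : ∀ v, (P v : V) = v + ω f v • e - ω e v • f := fun v => rfl
  have hPW : ∀ w : W, P w = w := fun w => Subtype.ext (by rw [hP, (hW w).1, (hW w).2]; simp)
  have hPe : P e = 0 := Subtype.ext (by rw [hP, halt, hfe]; simp)
  have hPf : P f = 0 := Subtype.ext (by rw [hP, halt, hef]; simp)
  have : Module.Projective R W := Module.Projective.of_split W.subtype P (by ext w; simp [hPW])
  have : Module.Finite R W := Module.Finite.of_surjective P fun w => ⟨w, hPW w⟩
  have : Module.Free R W := Module.free_of_flat_of_isLocalRing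
  let E : ((R × R) × W) ≃ₗ[R] V :=
    { toFun := fun z => z.1.1 • e + z.1.2 • f + z.2
      map_add' := fun z z' => by
        simp only [Prod.fst_add, Prod.snd_add, add_smul, Submodule.coe_add]
        abel
      map_smul' := fun c z => by simp [smul_smul]
      invFun := fun v => ((-ω f v, ω e v), P v)
      left_inv := fun ⟨⟨a, b⟩, w⟩ => by simp [halt, hef, hfe, hW w, hPe, hPf, hPW]
      right_inv := fun v => by
        simp only [hP, neg_smul]
        abel }
  let ωW : W →ₗ[R] Module.Dual R W := ω.compl₁₂ W.subtype W.subtype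
  have hωW : ∀ v w : W, ωW v w = ω v w := fun v w => rfl
  have hbijW : Function.Bijective ωW := by
    constructor
    · rw [← LinearMap.ker_eq_bot, LinearMap.ker_eq_bot']
      intro w hw
      refine Subtype.ext (hbij.1 ?_)
      ext v
      have h0 : ω w (P v) = 0 := by rw [← hωW, hw, LinearMap.zero_apply]
      rw [hP] at h0
      simpa [hW' w] using h0
    · intro g
      obtain ⟨v, hv⟩ := hbij.2 (g ∘ₗ P)
      have hvW : v ∈ W := by
        constructor
        · change ω e v = 0
          rw [hskew, hv, LinearMap.comp_apply, hPe, map_zero, neg_zero]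
        · change ω f v = 0
          rw [hskew, hv, LinearMap.comp_apply, hPf, map_zero, neg_zero]
      refine ⟨⟨v, hvW⟩, ?_⟩
      ext w
      rw [hωW, hv, LinearMap.comp_apply, hPW]
  have hrank : Module.finrank R W < N := by
    have h := E.finrank_eq
    rw [Module.finrank_prod, Module.finrank_prod, Module.finrank_self] at h
    omega
  obtain ⟨ι, hι, b, h₁, h₂, h₃, h₄⟩ := ih _ hrank ωW (fun w => halt w) hbijW rfl
  let B := ((((Module.Basis.singleton Unit R).prod (Module.Basis.singleton Unit R)).prod b).map
    E).reindex (Equiv.sumSumSumComm Unit Unit ι ι)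
  have hB₁ : ∀ i, B (.inl (.inl i)) = e := fun i => by simp [B, E]
  have hB₂ : ∀ i, B (.inr (.inl i)) = f := fun i => by simp [B, E]
  have hB₃ : ∀ i, B (.inl (.inr i)) = b (.inl i) := fun i => by simp [B, E]
  have hB₄ : ∀ i, B (.inr (.inr i)) = b (.inr i) := fun i => by simp [B, E]
  simp only [hωW] at h₁ h₂ h₃ h₄
  refine ⟨Unit ⊕ ι, inferInstance, B, ?_, ?_, ?_, ?_⟩
  · rintro (i | i) (j | j) <;> simp [hB₁, hB₃, halt, hW, hW', h₁]
  · rintro (i | i) (j | j) <;> simp [hB₂, hB₄, halt, hW, hW', h₂]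
  · rintro (i | i) <;> simp [hB₁, hB₂, hB₃, hB₄, hef, h₃]
  · rintro (i | i) (j | j) hij
    · exact absurd rfl hij
    · simp [hB₁, hB₄, hW]
    · simp [hB₂, hB₃, hW']
    · rw [hB₃, hB₄]
      exact h₄ i j fun h => hij (by rw [h])

end Symplectic

/-! ### Block resolutions -/

section BlockResolution

open Matrix

/-- In a symplectic basis of the middle module the adjoint differentials of a self-dual resolution
are the block matrices `(α β)` and `(-βᵗ, αᵗ)`. -/
lemma exists_isBlockResolution {R : Type u} [CommRing R] [IsLocalRing R] {n : ℕ} {F₂ F₁ M : Type u}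
    [AddCommGroup F₂] [Module R F₂] [AddCommGroup F₁] [Module R F₁]
    [AddCommGroup M] [Module R M] [Module.Free R F₂] [Module.Free R F₁]
    [Module.Finite R F₂] [Module.Finite R F₁] {d₂ : F₂ →ₗ[R] F₁}
    {d₁ : F₁ →ₗ[R] (Fin n → R)} {ε : (Fin n → R) →ₗ[R] M} (hinj : Function.Injective d₂)
    (hmid : Function.Exact d₂ d₁) (hright : Function.Exact d₁ ε) (hsurj : Function.Surjective ε)
    (hrank : Module.finrank R F₁ = Module.finrank R F₂ + n)
    {Φ₁ : F₁ →ₗ[R] Module.Dual R F₁} {Φ₀ : (Fin n → R) →ₗ[R] Module.Dual R F₂}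
    (halt : ∀ f, Φ₁ f f = 0) (hadj : ∀ f h, Φ₁ f (d₂ h) = Φ₀ (d₁ f) h)
    (hbij₁ : Function.Bijective Φ₁) (hbij₀ : Function.Bijective Φ₀) :
    ∃ α β : Matrix (Fin n) (Fin n) R, IsBlockResolution (-βᵀ) αᵀ α β ε := by
  have hskew : ∀ v w, Φ₁ v w = -Φ₁ w v := fun v w => by
    have h := halt (v + w)
    simp only [map_add, LinearMap.add_apply, halt, zero_add, add_zero] at h
    exact eq_neg_of_add_eq_zero_right h
  obtain ⟨ι, hι, b', hb'⟩ := exists_symplectic_basis Φ₁ halt hbij₁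
  let e₀ := LinearEquiv.ofBijective Φ₀ hbij₀
  have hn : Fintype.card ι = n := by
    have h1 := Module.finrank_eq_card_basis b'
    have h2 := e₀.finrank_eq
    rw [← (Module.Free.chooseBasis R F₂).toDualEquiv.finrank_eq, Module.finrank_fin_fun] at h2
    rw [Fintype.card_sum] at h1
    omega
  let σ := Fintype.equivFinOfCardEq hn
  obtain ⟨b, h₁, h₂, h₃, h₄⟩ : ∃ b : Module.Basis (Fin n ⊕ Fin n) R F₁,
      (∀ i j, Φ₁ (b (.inl i)) (b (.inl j)) = 0) ∧ (∀ i j, Φ₁ (b (.inr i)) (b (.inr j)) = 0) ∧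
      (∀ i, Φ₁ (b (.inl i)) (b (.inr i)) = 1) ∧
      (∀ i j, i ≠ j → Φ₁ (b (.inl i)) (b (.inr j)) = 0) := by
    refine ⟨b'.reindex (σ.sumCongr σ), ?_, ?_, ?_, ?_⟩
    · intro i j; simp [hb'.1]
    · intro i j; simp [hb'.2.1]
    · intro i; simp [hb'.2.2.1]
    · intro i j hij
      simpa using hb'.2.2.2 _ _ (fun h => hij (σ.symm.injective h))
  -- the coordinates of an element of the middle module are its pairings with the basis
  have hcoord : ∀ v i, b.repr v (.inr i) = Φ₁ (b (.inl i)) v ∧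
      b.repr v (.inl i) = -Φ₁ (b (.inr i)) v := fun v i => by
    have h₄' : ∀ j, Φ₁ (b (.inl i)) (b (.inr j)) = if i = j then 1 else 0 := fun j => by
      split_ifs with hij
      · rw [← hij, h₃]
      · exact h₄ i j hij
    have h₅' : ∀ j, Φ₁ (b (.inr i)) (b (.inl j)) = if i = j then -1 else 0 := fun j => by
      rw [hskew]
      split_ifs with hij
      · rw [← hij, h₃]
      · rw [h₄ j i (Ne.symm hij), neg_zero]
    constructor
    · conv_rhs => rw [← b.sum_repr v, map_sum]
      simp [Fintype.sum_sum_type, h₁, h₄']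
    · conv_rhs => rw [← b.sum_repr v, map_sum]
      simp [Fintype.sum_sum_type, h₂, h₅']
  let ψ : F₂ ≃ₗ[R] (Fin n → R) := (Module.evalEquiv R F₂).trans
    (e₀.dualMap.trans ((Pi.basisFun R (Fin n)).constr R).symm)
  have hψ : ∀ h i, ψ h i = Φ₀ (Pi.basisFun R (Fin n) i) h := fun h i => rfl
  have hΦ₀ : ∀ a h, Φ₀ a h = ∑ j, a j * ψ h j := fun a h => by
    conv_lhs => rw [← (Pi.basisFun R (Fin n)).sum_repr a, map_sum]
    simp [hψ, LinearMap.sum_apply]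
  let α : Matrix (Fin n) (Fin n) R := of fun i j => d₁ (b (.inl j)) i
  let β : Matrix (Fin n) (Fin n) R := of fun i j => d₁ (b (.inr j)) i
  have hτ : ∀ v, (fromCols α β).mulVecLin v = d₁ (b.equivFun.symm v) := fun v => by
    ext i
    rw [b.equivFun_symm_apply, map_sum]
    simp [mulVec, dotProduct, Fintype.sum_sum_type, α, β, mul_comm]
  have hρ : ∀ h, (fromRows (-βᵀ) αᵀ).mulVecLin (ψ h) = b.equivFun (d₂ h) := fun h => by
    ext (i | i)
    · rw [b.equivFun_apply, (hcoord _ i).2, hadj, hΦ₀]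
      simp [mulVec, dotProduct, β]
    · rw [b.equivFun_apply, (hcoord _ i).1, hadj, hΦ₀]
      simp [mulVec, dotProduct, α]
  refine ⟨α, β, ⟨?_, ?_, ?_, hsurj⟩⟩
  · have h : Function.Injective ((fromRows (-βᵀ) αᵀ).mulVecLin ∘ ψ) := by
      rw [show (fromRows (-βᵀ) αᵀ).mulVecLin ∘ ψ = b.equivFun ∘ d₂ from funext hρ]
      exact b.equivFun.injective.comp hinj
    exact (Function.Injective.of_comp_iff' _ ψ.bijective).mp h
  · intro v
    rw [hτ, hmid]
    constructor
    · rintro ⟨h, hh⟩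
      exact ⟨ψ h, by rw [hρ, hh, LinearEquiv.apply_symm_apply]⟩
    · rintro ⟨w, rfl⟩
      obtain ⟨h, rfl⟩ := ψ.surjective w
      exact ⟨h, by rw [hρ, LinearEquiv.symm_apply_apply]⟩
  · intro a
    rw [hright]
    constructor
    · rintro ⟨f, rfl⟩
      exact ⟨b.equivFun f, by rw [hτ, LinearEquiv.symm_apply_apply]⟩
    · rintro ⟨v, rfl⟩
      exact ⟨_, (hτ v).symm⟩

variable {R : Type u} [CommRing R] {M : Type u} [AddCommGroup M] [Module R M] {n : ℕ}

lemma IsBlockResolution.mul_transpose_eq {α β : Matrix (Fin n) (Fin n) R}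
    {ε : (Fin n → R) →ₗ[R] M} (h : IsBlockResolution (-βᵀ) αᵀ α β ε) : α * βᵀ = β * αᵀ := by
  have h0 : fromCols α β * fromRows (-βᵀ) αᵀ = 0 := by
    refine ext_of_mulVec_single fun j => ?_
    rw [← mulVec_mulVec, zero_mulVec]
    exact (h.exact_middle _).mpr ⟨_, rfl⟩
  rw [fromCols_mul_fromRows, mul_neg, neg_add_eq_zero] at h0
  exact h0

/-- A change of basis of the middle module by `T` preserves a block resolution. -/
lemma IsBlockResolution.of_change_of_basis {ρ₁ ρ₂ τ₁ τ₂ ρ₁' ρ₂' τ₁' τ₂' : Matrix (Fin n) (Fin n) R}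
    {ε : (Fin n → R) →ₗ[R] M} (h : IsBlockResolution ρ₁ ρ₂ τ₁ τ₂ ε)
    {T U : Matrix (Fin n ⊕ Fin n) (Fin n ⊕ Fin n) R} (hTU : T * U = 1) (hUT : U * T = 1)
    (hτ : fromCols τ₁' τ₂' = fromCols τ₁ τ₂ * T) (hρ : T * fromRows ρ₁' ρ₂' = fromRows ρ₁ ρ₂) :
    IsBlockResolution ρ₁' ρ₂' τ₁' τ₂' ε := by
  have hT : ∀ v, U *ᵥ T *ᵥ v = v := fun v => by rw [mulVec_mulVec, hUT, one_mulVec]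
  have hU : ∀ v, T *ᵥ U *ᵥ v = v := fun v => by rw [mulVec_mulVec, hTU, one_mulVec]
  have hτ' : ∀ v, (fromCols τ₁' τ₂').mulVecLin v = (fromCols τ₁ τ₂).mulVecLin (T *ᵥ v) :=
      fun v => by
    rw [hτ, mulVecLin_apply, mulVecLin_apply, mulVec_mulVec]
  have hρ' : ∀ w, T *ᵥ (fromRows ρ₁' ρ₂').mulVecLin w = (fromRows ρ₁ ρ₂).mulVecLin w := fun w => by
    rw [← hρ, mulVecLin_apply, mulVecLin_apply, mulVec_mulVec]
  refine ⟨fun v w hvw => h.injective ?_, fun v => ?_, fun a => ?_, h.surjective⟩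
  · rw [← hρ', hvw, hρ']
  · rw [hτ', h.exact_middle]
    refine exists_congr fun w => ?_
    rw [← hρ']
    exact ⟨fun h => by rw [← hT v, ← h, hT], fun h => by rw [h]⟩
  · rw [h.exact_right]
    constructor
    · rintro ⟨v, rfl⟩
      exact ⟨U *ᵥ v, by rw [hτ', hU]⟩
    · rintro ⟨v, rfl⟩
      exact ⟨_, (hτ' v).symm⟩

/-- A symplectic shear `(α, β) ↦ (α + βS, β)` by a symmetric matrix preserves the resolution. -/
lemma IsBlockResolution.shear_left {α β S : Matrix (Fin n) (Fin n) R} {ε : (Fin n → R) →ₗ[R] M}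
    (h : IsBlockResolution (-βᵀ) αᵀ α β ε) (hS : Sᵀ = S) :
    IsBlockResolution (-βᵀ) (α + β * S)ᵀ (α + β * S) β ε := by
  refine h.of_change_of_basis (T := fromBlocks 1 0 S 1) (U := fromBlocks 1 0 (-S) 1) ?_ ?_ ?_ ?_
  · simp [fromBlocks_multiply]
  · simp [fromBlocks_multiply]
  · simp [fromCols_mul_fromBlocks]
  · simp [fromBlocks_mul_fromRows, transpose_mul, hS]

/-- A symplectic shear `(α, β) ↦ (α, β + αS)` by a symmetric matrix preserves the resolution. -/
lemma IsBlockResolution.shear_right {α β S : Matrix (Fin n) (Fin n) R} {ε : (Fin n → R) →ₗ[R] M}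
    (h : IsBlockResolution (-βᵀ) αᵀ α β ε) (hS : Sᵀ = S) :
    IsBlockResolution (-(β + α * S)ᵀ) αᵀ α (β + α * S) ε := by
  refine h.of_change_of_basis (T := fromBlocks 1 S 0 1) (U := fromBlocks 1 (-S) 0 1) ?_ ?_ ?_ ?_
  · simp [fromBlocks_multiply]
  · simp [fromBlocks_multiply]
  · simp [fromCols_mul_fromBlocks, add_comm]
  · simp [fromBlocks_mul_fromRows, transpose_mul, hS]

end BlockResolution

/-! ### Lagrangian subspaces in general position -/

section GeneralPosition

open Matrix Polynomial IsLocalRing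

/-- Every Lagrangian subspace is transversal to a coordinate Lagrangian: if `(a b)` has rank `n` and
`a bᵗ` is symmetric, then some choice of one of the `j`-th columns of `a` and `b` for each `j` gives
an invertible matrix. Take columns of `a` that form a basis of its column space, and the
complementary columns of `b`. -/
lemma exists_det_ite_ne_zero {K ι : Type*} [Field K] [Fintype ι] [DecidableEq ι]
    {a b : Matrix ι ι K}
    (hab : a * bᵀ = b * aᵀ) (hrank : ∀ v, v ᵥ* a = 0 → v ᵥ* b = 0 → v = 0) :
    ∃ χ : ι → Prop, ∃ _ : DecidablePred χ,
      (of fun i j => if χ j then b i j else a i j : Matrix ι ι K).det ≠ 0 := by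
  classical
  obtain ⟨κ, s, hs, hspan, hli⟩ := exists_linearIndependent' K (fun j => a.col j)
  refine ⟨fun j => j ∉ Set.range s, inferInstance, fun hdet => ?_⟩
  obtain ⟨v, hv0, hv⟩ := exists_vecMul_eq_zero_iff.mpr hdet
  have hvj : ∀ j, (if j ∉ Set.range s then (v ᵥ* b) j else (v ᵥ* a) j) = 0 := fun j => by
    refine Eq.trans ?_ (congrFun hv j)
    split_ifs with h
    · simp only [vecMul, dotProduct, of_apply, if_neg (not_not.mpr h)]
    · simp only [vecMul, dotProduct, of_apply, if_pos h]
  have hva : v ᵥ* a = 0 := by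
    have hle : Submodule.span K (Set.range fun j => a.col j) ≤
        LinearMap.ker (dotProductBilin K K v) := by
      rw [← hspan, Submodule.span_le]
      rintro _ ⟨k, rfl⟩
      have := hvj (s k)
      rw [if_neg (by simp)] at this
      exact this
    ext j
    exact hle (Submodule.subset_span ⟨j, rfl⟩)
  have hsupp : ∀ j, j ∉ Set.range s → (v ᵥ* b) j = 0 := fun j hj => by
    have := hvj j
    rwa [if_pos hj] at this
  have haw : a *ᵥ (v ᵥ* b) = 0 := by
    rw [← mulVec_transpose, mulVec_mulVec, hab, ← mulVec_mulVec, mulVec_transpose, hva, mulVec_zero]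
  have hvb : v ᵥ* b = 0 := by
    have : Finite κ := Finite.of_injective s hs
    have := Fintype.ofFinite κ
    have h0 : ∑ k, (v ᵥ* b) (s k) • a.col (s k) = 0 := by
      rw [← haw]
      ext i
      rw [Finset.sum_apply]
      refine Fintype.sum_of_injective s hs _ _ (fun j hj => ?_) fun k => ?_
      · rw [hsupp j hj, mul_zero]
      · simp [mul_comm]
    have h1 := Fintype.linearIndependent_iff.mp hli _ h0
    ext j
    by_cases hj : j ∈ Set.range s
    · obtain ⟨k, rfl⟩ := hj
      exact h1 k
    · exact hsupp j hj
  exact hv0 (hrank v hva hvb)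

variable {R : Type*} [CommRing R] [IsLocalRing R]

/-- A polynomial that does not vanish identically modulo any of finitely many primes takes a value
outside all of them at a power of `t`: modulo each prime the powers of `t` are distinct, so only
finitely many of them are roots. -/
lemma exists_eval_pow_notMem {t : R} (ht : t ∈ maximalIdeal R) {Q : Set (Ideal R)} (hQ : Q.Finite)
    (hprime : ∀ p ∈ Q, p.IsPrime) (htQ : ∀ p ∈ Q, t ∉ p) (f : R[X])
    (hf : ∀ p ∈ Q, ∃ r, f.eval r ∉ p) : ∃ k : ℕ, k ≠ 0 ∧ ∀ p ∈ Q, f.eval (t ^ k) ∉ p := by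
  have hfin : ∀ p ∈ Q, {k : ℕ | f.eval (t ^ k) ∈ p}.Finite := by
    intro p hp
    have := hprime p hp
    classical
    let φ := Ideal.Quotient.mk p
    have hφ0 : f.map φ ≠ 0 := fun h0 => by
      obtain ⟨r, hr⟩ := hf p hp
      refine hr (Ideal.Quotient.eq_zero_iff_mem.mp ?_)
      change φ (f.eval r) = 0
      rw [← eval_map_apply, h0, eval_zero]
    have hne : ∀ k l : ℕ, k < l → φ (t ^ k) ≠ φ (t ^ l) := fun k l hkl h => by
      rw [Ideal.Quotient.eq] at h
      obtain ⟨c, rfl⟩ := Nat.exists_eq_add_of_lt hkl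
      have h1 : t ^ k * (1 - t ^ (c + 1)) ∈ p := by
        convert h using 1
        ring
      rcases this.mem_or_mem h1 with h2 | h2
      · exact htQ p hp (this.mem_of_pow_mem _ h2)
      · refine this.ne_top (Ideal.eq_top_of_isUnit_mem _ h2 ?_)
        exact isUnit_one_sub_self_of_mem_nonunits _
          (Ideal.pow_mem_of_mem _ ht _ (Nat.succ_pos c))
    have hinj : Function.Injective fun k : ℕ => φ (t ^ k) := fun k l hkl => by
      rcases lt_trichotomy k l with h | h | h
      · exact absurd hkl (hne k l h)
      · exact h
      · exact absurd hkl.symm (hne l k h)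
    refine Set.Finite.subset (Set.Finite.preimage hinj.injOn
      (f.map φ).roots.toFinset.finite_toSet) fun k hk => ?_
    simp only [Set.mem_preimage, Finset.mem_coe, Multiset.mem_toFinset]
    rw [mem_roots hφ0, IsRoot, eval_map_apply]
    exact Ideal.Quotient.eq_zero_iff_mem.mpr hk
  obtain ⟨k, hk⟩ := ((hQ.biUnion hfin).union (Set.finite_singleton 0)).exists_notMem
  simp only [Set.mem_union, Set.mem_iUnion, not_or, not_exists] at hk
  exact ⟨k, hk.2, fun p hp h => hk.1 p hp h⟩

/-- The columnwise interpolation `(1 - x) a + x b` between two square matrices. -/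
noncomputable def columnInterpolation {S ι : Type*} [CommRing S] (a b : Matrix ι ι S) (x : ι → S) :
    Matrix ι ι S :=
  of fun i j => (1 - x j) * a i j + x j * b i j

/-- If for each of finitely many primes some interpolation of `a` and `b` has determinant outside
the prime, a single interpolation with parameters in the maximal ideal does so for all primes. The
primes are added one at a time, moving along the line from the parameters found so far to those that
suit the new prime. -/
lemma exists_det_columnInterpolation_notMem {ι : Type*} [Fintype ι] [DecidableEq ι]
    (a b : Matrix ι ι R) {t : R} (ht : t ∈ maximalIdeal R) {Q : Set (Ideal R)} (hQ : Q.Finite)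
    (hprime : ∀ p ∈ Q, p.IsPrime) (htQ : ∀ p ∈ Q, t ∉ p)
    (hdet : ∀ p ∈ Q, ∃ x, (columnInterpolation a b x).det ∉ p) :
    ∃ x, (∀ j, x j ∈ maximalIdeal R) ∧ ∀ p ∈ Q, (columnInterpolation a b x).det ∉ p := by
  induction Q, hQ using Set.Finite.induction_on with
  | empty => exact ⟨0, fun j => zero_mem _, fun p hp => hp.elim⟩
  | @insert p Q hpQ hQ ih =>
    obtain ⟨x, hx, hxQ⟩ := ih (fun q hq => hprime q (.inr hq)) (fun q hq => htQ q (.inr hq))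
      (fun q hq => hdet q (.inr hq))
    obtain ⟨y, hy⟩ := hdet p (.inl rfl)
    let f : R[X] := (columnInterpolation (a.map C) (b.map C)
      (fun j => C (x j) + X * (C (y j) - C (x j)))).det
    have hf : ∀ s, f.eval s = (columnInterpolation a b fun j => x j + s * (y j - x j)).det := by
      intro s
      rw [← coe_evalRingHom, RingHom.map_det]
      congr 1
      ext i j
      simp [columnInterpolation]
    obtain ⟨k, hk0, hk⟩ := exists_eval_pow_notMem ht (hQ.insert p) hprime htQ f (by
      rintro q (rfl | hq)
      · refine ⟨1, ?_⟩
        rw [hf]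
        simpa using hy
      · refine ⟨0, ?_⟩
        rw [hf]
        simpa using hxQ q hq)
    refine ⟨_, fun j => ?_, fun q hq => by rw [← hf (t ^ k)]; exact hk q hq⟩
    exact add_mem (hx j) (Ideal.mul_mem_right _ _
      (Ideal.pow_mem_of_mem _ ht _ (Nat.pos_of_ne_zero hk0)))

/-- General position: if `a bᵗ` is symmetric and the columns of `(a b)` span a submodule containing
`t Rⁿ`, then a diagonal shear moves `det a` out of finitely many given primes not containing `t`. -/
lemma exists_det_add_mul_diagonal_notMem {ι : Type*} [Fintype ι] [DecidableEq ι]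
    {a b : Matrix ι ι R} (hab : a * bᵀ = b * aᵀ) {t : R} (ht : t ∈ maximalIdeal R)
    {c d : Matrix ι ι R} (hcd : a * c + b * d = t • 1) {Q : Set (Ideal R)} (hQ : Q.Finite)
    (hprime : ∀ p ∈ Q, p.IsPrime) (htQ : ∀ p ∈ Q, t ∉ p) :
    ∃ y : ι → R, ∀ p ∈ Q, (a + b * diagonal y).det ∉ p := by
  have hdet : ∀ p ∈ Q, ∃ x, (columnInterpolation a b x).det ∉ p := by
    intro p hp
    have := hprime p hp
    let φ : R →+* FractionRing (R ⧸ p) := (algebraMap (R ⧸ p) _).comp (Ideal.Quotient.mk p)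
    have hφ : ∀ r, φ r = 0 ↔ r ∈ p := fun r => by
      rw [RingHom.comp_apply, FaithfulSMul.algebraMap_eq_zero_iff, Ideal.Quotient.eq_zero_iff_mem]
    have hab' : a.map φ * (b.map φ)ᵀ = b.map φ * (a.map φ)ᵀ := by
      rw [← transpose_map, ← transpose_map, ← Matrix.map_mul, ← Matrix.map_mul, hab]
    have hcd' : a.map φ * c.map φ + b.map φ * d.map φ = φ t • 1 := by
      rw [← Matrix.map_mul, ← Matrix.map_mul, ← Matrix.map_add _ (map_add φ), hcd]
      ext i j
      simp [Matrix.one_apply, apply_ite φ]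
    obtain ⟨χ, hχ, hne⟩ := exists_det_ite_ne_zero hab' fun v ha hb => by
      have h1 : φ t • v = 0 := by
        rw [← vecMul_one (φ t • v), smul_vecMul, ← vecMul_smul, ← hcd', vecMul_add, ← vecMul_vecMul,
          ← vecMul_vecMul, ha, hb, zero_vecMul, zero_vecMul, add_zero]
      exact (smul_eq_zero.mp h1).resolve_left fun h => htQ p hp ((hφ t).mp h)
    refine ⟨fun j => if χ j then 1 else 0, fun hmem => hne ?_⟩
    rw [← hφ, RingHom.map_det] at hmem
    rw [← hmem]
    congr 1
    ext i j
    by_cases h : χ j <;> simp [columnInterpolation, h]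
  obtain ⟨x, hx, hxQ⟩ := exists_det_columnInterpolation_notMem a b ht hQ hprime htQ hdet
  have hunit : ∀ j, IsUnit (1 - x j) := fun j => isUnit_one_sub_self_of_mem_nonunits _ (hx j)
  -- the interpolation is the shear by `x / (1 - x)`, up to the units `1 - x`
  refine ⟨fun j => x j * ↑(hunit j).unit⁻¹, fun p hp hmem => hxQ p hp ?_⟩
  have : columnInterpolation a b x =
      (a + b * diagonal fun j => x j * ↑(hunit j).unit⁻¹) * diagonal fun j => 1 - x j := by
    ext i j
    have h1 : (↑(hunit j).unit⁻¹ : R) * (1 - x j) = 1 := (hunit j).val_inv_mul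
    simp only [columnInterpolation, of_apply, mul_diagonal, Matrix.add_apply]
    linear_combination (-(b i j * x j)) * h1
  rw [this, det_mul]
  exact Ideal.mul_mem_right _ _ hmem

end GeneralPosition

/-! ### Determinants forming a regular sequence -/

section RegularDeterminants

open Matrix IsLocalRing

/-- If `x, y` is a regular sequence and `d` a regular element, then no associated prime of `R / d`
contains both `x` and `y`. -/
lemma notMem_or_notMem_of_isAssociatedPrime_quotSMulTop {R : Type*} [CommRing R]
    [IsNoetherianRing R] {x y d : R} (hxreg : IsSMulRegular R x)
    (hyreg : IsSMulRegular (QuotSMulTop x R) y) (hd : IsSMulRegular R d) {q : Ideal R}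
    (hq : IsAssociatedPrime q (QuotSMulTop d R)) :
    x ∉ q ∨ y ∉ q := by
  by_contra! hcon
  obtain ⟨hprime, z, hz⟩ := isAssociatedPrime_iff.mp hq
  obtain ⟨z, rfl⟩ := Submodule.Quotient.mk_surjective _ z
  have hmem : ∀ r, r ∈ q ↔ d ∣ r * z := fun r => by
    rw [hz, Submodule.mem_colon_singleton, Submodule.mem_bot, ← Submodule.Quotient.mk_smul,
      Submodule.Quotient.mk_eq_zero, Submodule.mem_smul_pointwise_iff_exists]
    constructor
    · rintro ⟨c, -, hc⟩
      exact ⟨c, hc.symm⟩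
    · rintro ⟨c, hc⟩
      exact ⟨c, trivial, hc.symm⟩
  obtain ⟨u, hu⟩ := (hmem x).mp hcon.1
  obtain ⟨v, hv⟩ := (hmem y).mp hcon.2
  have huv : y * u = x * v := hd (by
    simp only [smul_eq_mul]
    linear_combination -y * hu + x * hv)
  obtain ⟨w, rfl⟩ := hyreg.dvd_of_dvd_mul ⟨v, huv⟩
  have hzw : z = d * w := hxreg (by
    simp only [smul_eq_mul]
    linear_combination hu)
  exact hprime.ne_top ((Ideal.eq_top_iff_one q).mpr ((hmem 1).mpr ⟨w, by rw [one_mul, hzw]⟩))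

/-- An ideal containing a regular sequence of length two contains an element that is regular modulo
any given regular element. -/
lemma exists_mem_isSMulRegular_quotSMulTop {R : Type*} [CommRing R] [IsNoetherianRing R]
    {I : Ideal R} {x y d : R} (hx : x ∈ I) (hy : y ∈ I) (hxreg : IsSMulRegular R x)
    (hyreg : IsSMulRegular (QuotSMulTop x R) y) (hd : IsSMulRegular R d) :
    ∃ t ∈ I, IsSMulRegular (QuotSMulTop d R) t := by
  by_contra! hcon
  have hsub : (I : Set R) ⊆ ⋃ p ∈ associatedPrimes R (QuotSMulTop d R), (p : Set R) := by
    rw [biUnion_associatedPrimes_eq_compl_regular]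
    exact fun t ht => hcon t ht
  obtain ⟨q, hq, hIq⟩ := (Ideal.subset_union_prime_finite (associatedPrimes.finite R _)
    (f := fun p => p) ⊥ ⊥ (fun p hp _ _ => hp.1)).mp hsub
  rcases notMem_or_notMem_of_isAssociatedPrime_quotSMulTop hxreg hyreg hd hq with h | h
  · exact h (hIq hx)
  · exact h (hIq hy)

lemma isSMulRegular_iff_forall_notMem {R M : Type*} [CommRing R] [IsNoetherianRing R]
    [AddCommGroup M] [Module R M] {r : R} :
    IsSMulRegular M r ↔ ∀ p ∈ associatedPrimes R M, r ∉ p := by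
  have h := Set.ext_iff.mp (biUnion_associatedPrimes_eq_compl_regular R M) r
  simp only [Set.mem_iUnion, Set.mem_compl_iff, SetLike.mem_coe] at h
  rw [← not_iff_not, ← Set.mem_ofPred_eq (p := fun r => IsSMulRegular M r), ← h]
  push Not
  simp

variable {R : Type u} [CommRing R] {M : Type u} [AddCommGroup M] [Module R M] {n : ℕ}
  {ρ₁ ρ₂ α β : Matrix (Fin n) (Fin n) R} {ε : (Fin n → R) →ₗ[R] M}

lemma IsBlockResolution.apply_mulVec_left (h : IsBlockResolution ρ₁ ρ₂ α β ε) (v : Fin n → R) :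
    ε (α *ᵥ v) = 0 :=
  (h.exact_right _).mpr ⟨Sum.elim v 0, by simp [fromCols_mulVec]⟩

lemma IsBlockResolution.apply_mulVec_right (h : IsBlockResolution ρ₁ ρ₂ α β ε) (v : Fin n → R) :
    ε (β *ᵥ v) = 0 :=
  (h.exact_right _).mpr ⟨Sum.elim 0 v, by simp [fromCols_mulVec]⟩

lemma Matrix.det_mem_annihilator {a : Matrix (Fin n) (Fin n) R} (hε : Function.Surjective ε)
    (h : ∀ v, ε (a *ᵥ v) = 0) : a.det ∈ Module.annihilator R M := by
  rw [Module.mem_annihilator]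
  intro m
  obtain ⟨v, rfl⟩ := hε m
  rw [← map_smul, ← h (a.adjugate *ᵥ v), mulVec_mulVec, mul_adjugate, smul_mulVec, one_mulVec]

/-- The image of `(α β)` contains `t Rⁿ` if `t` kills the cokernel. -/
lemma IsBlockResolution.exists_mul_add_mul_eq (h : IsBlockResolution ρ₁ ρ₂ α β ε) {t : R}
    (ht : t ∈ Module.annihilator R M) :
    ∃ c d : Matrix (Fin n) (Fin n) R, α * c + β * d = t • 1 := by
  have hex : ∀ j : Fin n, ∃ w, (fromCols α β).mulVecLin w = t • Pi.single j 1 := fun j => by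
    refine (h.exact_right _).mp ?_
    rw [map_smul]
    exact Module.mem_annihilator.mp ht _
  choose w hw using hex
  refine ⟨of fun i j => w j (.inl i), of fun i j => w j (.inr i), ?_⟩
  ext i j
  have := congrFun (hw j) i
  rw [mulVecLin_apply, fromCols_mulVec] at this
  simpa [mul_apply, mulVec, dotProduct, one_apply, Pi.single_apply] using this

/-- The determinants of a block resolution of a nonzero module whose annihilator contains a regular
sequence of length two form a regular sequence after two symplectic shears. -/
lemma IsBlockResolution.exists_isRegular_det [IsLocalRing R] [IsNoetherianRing R] [Nontrivial M]
    (h : IsBlockResolution (-βᵀ) αᵀ α β ε) {x y : R} (hx : x ∈ Module.annihilator R M)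
    (hy : y ∈ Module.annihilator R M) (hxreg : IsSMulRegular R x)
    (hyreg : IsSMulRegular (QuotSMulTop x R) y) :
    ∃ α' β' : Matrix (Fin n) (Fin n) R, IsBlockResolution (-β'ᵀ) α'ᵀ α' β' ε ∧
      IsRegular R [α'.det, β'.det] := by
  have hle : Module.annihilator R M ≤ maximalIdeal R :=
    le_maximalIdeal fun h => not_subsingleton M (Module.annihilator_eq_top_iff.mp h)
  obtain ⟨c, d, hcd⟩ := h.exists_mul_add_mul_eq hx
  obtain ⟨s, hs⟩ := exists_det_add_mul_diagonal_notMem h.mul_transpose_eq (hle hx) hcd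
    (associatedPrimes.finite R R) (fun p hp => hp.1) (isSMulRegular_iff_forall_notMem.mp hxreg)
  have h' := h.shear_left (diagonal_transpose s)
  set α' := α + β * diagonal s
  have hreg₁ : IsSMulRegular R α'.det := isSMulRegular_iff_forall_notMem.mpr hs
  obtain ⟨t, ht, htreg⟩ := exists_mem_isSMulRegular_quotSMulTop hx hy hxreg hyreg hreg₁
  obtain ⟨c', d', hcd'⟩ := h'.exists_mul_add_mul_eq ht
  obtain ⟨s', hs'⟩ := exists_det_add_mul_diagonal_notMem h'.mul_transpose_eq.symm (hle ht)
    ((add_comm _ _).trans hcd') (associatedPrimes.finite R (QuotSMulTop α'.det R))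
    (fun p hp => hp.1) (isSMulRegular_iff_forall_notMem.mp htreg)
  have h'' := h'.shear_right (diagonal_transpose s')
  refine ⟨α', _, h'', IsRegular.of_isWeaklyRegular_of_mem_maximalIdeal R ?_ ?_⟩
  · simp only [List.mem_cons, List.not_mem_nil, or_false, forall_eq_or_imp, forall_eq]
    exact ⟨hle (det_mem_annihilator h''.surjective h''.apply_mulVec_left),
      hle (det_mem_annihilator h''.surjective h''.apply_mulVec_right)⟩
  · rw [isWeaklyRegular_cons_iff, isWeaklyRegular_singleton_iff]
    exact ⟨hreg₁, isSMulRegular_iff_forall_notMem.mpr hs'⟩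

end RegularDeterminants

theorem lemma4p1 (R A : Type u) [CommRing R] [IsLocalRing R] [IsNoetherianRing R]
    (hR : IsCohenMacaulayLocal R) (h2 : (2 : R) ∉ IsLocalRing.maximalIdeal R)
    [CommRing A] [Algebra R A] (hA : IsGorensteinAlgebraCodimTwo R A)
    (hpd : HasProjectiveDimensionLE (ModuleCat.of R A) 2) :
    ∃ (n : ℕ) (α β : Matrix (Fin n) (Fin n) R) (ε : (Fin n → R) →ₗ[R] A),
      IsBlockResolution (-β.transpose) α.transpose α β ε ∧
      α * β.transpose = β * α.transpose ∧
      IsKoszulType (-β.transpose) α.transpose α β := by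
  have := hA.finite
  have hunit : IsUnit (2 : R) := by simpa using h2
  obtain ⟨e, he⟩ := hA.duality
  have hnt : Nontrivial A := by
    rw [← Module.supportDim_ne_bot_iff_nontrivial R]
    intro h
    have hdim := hA.codim
    rw [h, WithBot.bot_add] at hdim
    exact ringKrullDim_ne_bot hdim.symm
  obtain ⟨x, hx, y, hy, hxreg, hyreg⟩ := exists_regular_pair_mem_annihilator hR A hA.codim
  obtain ⟨n, m, F₂, _, _, _, _, d₂, d₁, ε, hres⟩ := exists_isMinimalResolution (R := R) A hpd
  obtain ⟨Φ₁, Φ₀, halt, hadj, hbij₁, hbij₀⟩ :=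
    exists_perfect_pairings hunit hres e he hx hy hxreg hyreg
  have hrank := finrank_eq_add_of_annihilated hres.injective hres.exact_middle hres.exact_right
    hx hxreg
  rw [Module.finrank_fin_fun R (n := n)] at hrank
  obtain ⟨α₀, β₀, h₀⟩ := exists_isBlockResolution hres.injective hres.exact_middle
    hres.exact_right hres.surjective hrank halt hadj hbij₁ hbij₀
  obtain ⟨α, β, h, hreg⟩ := h₀.exists_isRegular_det hx hy hxreg hyreg
  -- the block resolution has `ρ₁ = -βᵗ` and `ρ₂ = αᵗ`, so the unit is `1`
  refine ⟨n, α, β, ε, h, h.mul_transpose_eq, hreg, 1, ?_, ?_⟩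
  · rw [Matrix.det_neg, Matrix.det_transpose, Fintype.card_fin, Units.val_one, mul_one]
  · rw [Matrix.det_transpose, Units.val_one, one_mul]
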